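/- **Notation and definitions.** Let $d\in\mathbb N$, let $|\cdot|$ and $\langle\cdot,\cdot\rangle$ be the Euclidean norm and inner product on $\mathbb R^d$, and let $\widehat\mu(z)=\int e^{i\langle z,x\rangle}\,\mu(dx)$ be the characteristic function of a probability distribution $\mu$ on $\mathbb R^d$. - A probability distribution $\mu$ on $\mathbb R^d$ is *infinitely divisible* if for every integer $n\ge 1$ it is the $n$-fold convolution of some probability distribution with itself. It is *quasi-infinitely divisible* if there are infinitely divisible distributions $\mu_1,\mu_2$ on $\mathbb R^d$ with $\widehat\mu(z)=\widehat\mu_1(z)/\widehat\mu_2(z)$ for all $z\in\mathbb R^d$. - A *representation function* is a bounded, Borel measurable $c:\mathbb R^d\to\mathbb R^d$ with $\lim_{x\to0}|x|^{-2}|c(x)-x|=0$. - Let $\nu$ be a real-valued function on the Borel sets of $\mathbb R^d$ bounded away from $0$ whose restriction to the Borel subsets of $\{|x|\ge r\}$ is a finite signed measure for every $r>0$. Its positive part $\nu^+$ and negative part $\nu^-$ are the unique Borel measures on $\mathbb R^d$ with $\nu^\pm(\{0\})=0$ that coincide, on the Borel subsets of $\{|x|\ge r\}$, with the positive and negative part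 (Jordan decomposition) of that restriction, for every $r>0$. One calls $\nu$ a *quasi-Lévy type measure* if $\int (1\wedge|x|^2)\,\nu^\pm(dx)<\infty$ for both signs, and sets $\int f\,d\nu=\int f\,d\nu^+-\int f\,d\nu^-$ for $f$ integrable with respect to $\nu^+$ and $\nu^-$. - A quasi-infinitely divisible distribution $\mu$ has *characteristic triplet* $(A,\nu,\gamma)_c$ with respect to a representation function $c$ if $A\in\mathbb R^{d\times d}$ is symmetric, $\nu$ is a quasi-Lévy type measure, $\gamma\in\mathbb R^d$, and for all $z\in\mathbb R^d$ $$\widehat\mu(z)=\exp\Big(i\langle\gamma,z\rangle-\tfrac12\langle z,Az\rangle+\int_{\mathbb R^d}\big(e^{i\langle z,x\rangle}-1-i\langle z,c(x)\rangle\big)\,\nu(dx)\Big).$$ - $C_\#$ is the set of all bounded continuous $f:\mathbb R^d\to\mathbb R$ vanishing on a neighbourhood of $0$. **Theorem.** Let $c:\mathbb R^d\to\mathbb R^d$ be a continuous representation function. Let $(\mu_n)_{n\in\mathbb N}$ be a sequence of quasi-infinitely divisible distributions on $\mathbb R^d$ with characteristic triplets $(A_n,\nu_n,\gamma_n)_c$,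 and let $\mu$ be a quasi-infinitely divisible distribution on $\mathbb R^d$ with characteristic triplet $(A,\nu,\gamma)_c$. Suppose that the following conditions hold. 1. For all $f\in C_\#$, $$\lim_{n\to\infty}\int_{\mathbb R^d} f(x)\,\nu_n^+(dx)=\int_{\mathbb R^d} f(x)\,\nu^+(dx)\quad\text{and}\quad\lim_{n\to\infty}\int_{\mathbb R^d} f(x)\,\nu_n^-(dx)=\int_{\mathbb R^d} f(x)\,\nu^-(dx).$$ 2. If $A_{n,\varepsilon}$ is the symmetric matrix defined by $\langle z,A_{n,\varepsilon}z\rangle=\langle z,A_nz\rangle+\int_{|x|\le\varepsilon}\langle z,x\rangle^2\,\nu_n^+(dx)$ for $n\in\mathbb N$ and $\varepsilon>0$, then $$\lim_{\varepsilon\downarrow0}\limsup_{n\to\infty}\big|\langle z,A_{n,\varepsilon}z\rangle-\langle z,Az\rangle\big|=0\quad\text{for all }z\in\mathbb R^d.$$ 3. $\displaystyle\lim_{\varepsilon\downarrow0}\limsup_{n\to\infty}\int_{|x|\le\varepsilon}|x|^2\,\nu_n^-(dx)=0.$ 4. $\gamma_n\to\gamma$ as $n\to\infty$. Then $\mu_n$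 converges weakly to $\mu$ as $n\to\infty$. (Upper limits are taken in $[0,\infty]$.) -/

import Mathlib

open MeasureTheory Filter Topology Set
open scoped ENNReal NNReal BoundedContinuousFunction Function RealInnerProductSpace

noncomputable section

namespace QID

/-! ### Infinitely divisible and quasi-infinitely divisible distributions -/

/-- The `n`-fold convolution of `ρ` with itself. -/
def convPow {d : ℕ} (ρ : Measure (EuclideanSpace ℝ (Fin d))) :
    ℕ → Measure (EuclideanSpace ℝ (Fin d))
  | 0 => Measure.dirac 0
  | n + 1 => convPow ρ n ∗ ρ

/-- `μ` is infinitely divisible: for every `n ≥ 1` it is the `n`-fold convolution of some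
probability distribution with itself. -/
def IsInfinitelyDivisible {d : ℕ} (μ : ProbabilityMeasure (EuclideanSpace ℝ (Fin d))) : Prop :=
  ∀ n : ℕ, 1 ≤ n → ∃ ρ : ProbabilityMeasure (EuclideanSpace ℝ (Fin d)),
    convPow (ρ : Measure (EuclideanSpace ℝ (Fin d))) n = μ

/-- `μ` is quasi-infinitely divisible: its characteristic function is the quotient of the
characteristic functions of two infinitely divisible distributions. (The characteristic function
of an infinitely divisible distribution has no zeros.) -/
def IsQuasiInfinitelyDivisible {d : ℕ}
    (μ : ProbabilityMeasure (EuclideanSpace ℝ (Fin d))) : Prop :=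
  ∃ μ₁ μ₂ : ProbabilityMeasure (EuclideanSpace ℝ (Fin d)),
    IsInfinitelyDivisible μ₁ ∧ IsInfinitelyDivisible μ₂ ∧
      ∀ z : EuclideanSpace ℝ (Fin d),
        charFun (μ : Measure (EuclideanSpace ℝ (Fin d))) z =
          charFun (μ₁ : Measure (EuclideanSpace ℝ (Fin d))) z /
            charFun (μ₂ : Measure (EuclideanSpace ℝ (Fin d))) z

/-! ### Quasi-Lévy type measures -/

/-- The region `{x : |x| ≥ r}`. -/
def far (d : ℕ) (r : ℝ) : Set (EuclideanSpace ℝ (Fin d)) := {x | r ≤ ‖x‖}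

/-- The Borel sets contained in `{x : |x| ≥ r}`. -/
def borelFar (d : ℕ) (r : ℝ) : Set (Set (EuclideanSpace ℝ (Fin d))) :=
  {B | MeasurableSet B ∧ B ⊆ far d r}

/-- The Borel sets that are bounded away from `0`. -/
def borelOffZero (d : ℕ) : Set (Set (EuclideanSpace ℝ (Fin d))) :=
  ⋃ r : {r : ℝ // 0 < r}, borelFar d r

/-- A real-valued set function on the Borel sets bounded away from `0` whose restriction to
the Borel sets of `{x : |x| ≥ r}` is a finite signed measure for every `r > 0`.
As for `VectorMeasure`, it is given the value `0` on all other sets. -/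
structure SignedMeasureOffZero (d : ℕ) where
  measureOf : Set (EuclideanSpace ℝ (Fin d)) → ℝ
  measureOf_of_notMem : ∀ B, B ∉ borelOffZero d → measureOf B = 0
  measureOf_empty : measureOf ∅ = 0
  hasSum_iUnion : ∀ r : ℝ, 0 < r → ∀ B : ℕ → Set (EuclideanSpace ℝ (Fin d)),
    (∀ i, B i ∈ borelFar d r) → Pairwise (Disjoint on B) →
      HasSum (fun i => measureOf (B i)) (measureOf (⋃ i, B i))

theorem measurableSet_far (d : ℕ) (r : ℝ) : MeasurableSet (far d r) :=
  measurableSet_le measurable_const measurable_norm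

namespace SignedMeasureOffZero

variable {d : ℕ} (ν : SignedMeasureOffZero d)

open Classical in
/-- The restriction of `ν` to `{x : |x| ≥ r}`, as a signed measure on the whole space that does
not charge `{x : |x| < r}`. -/
def restrictFar (r : ℝ) (hr : 0 < r) : SignedMeasure (EuclideanSpace ℝ (Fin d)) where
  measureOf' B := if MeasurableSet B then ν.measureOf (B ∩ far d r) else 0
  empty' := by simp [ν.measureOf_empty]
  not_measurable' B hB := by simp [hB]
  m_iUnion' B hB hdisj := by
    simp only [hB, MeasurableSet.iUnion hB, if_true, Set.iUnion_inter]
    refine ν.hasSum_iUnion r hr _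
      (fun i => ⟨(hB i).inter (measurableSet_far d r), Set.inter_subset_right⟩) ?_
    intro i j hij
    exact (hdisj hij).mono Set.inter_subset_left Set.inter_subset_left

/-- The shells `{1 ≤ |x|}`, `{1/2 ≤ |x| < 1}`, `{1/3 ≤ |x| < 1/2}`, …, which partition the
complement of `0`. -/
def shell (d : ℕ) : ℕ → Set (EuclideanSpace ℝ (Fin d)) :=
  disjointed fun k : ℕ => far d (1 / ((k : ℝ) + 1))

/-- The positive part `ν⁺`: the measure on the whole space that agrees on the Borel subsets of
`{x : |x| ≥ r}` with the positive part of the restriction of `ν`, for every `r > 0`, and has no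
mass at `0`; see `posPart_apply` and `posPart_singleton_zero`. -/
def posPart : Measure (EuclideanSpace ℝ (Fin d)) :=
  Measure.sum fun k : ℕ =>
    (ν.restrictFar (1 / ((k : ℝ) + 1)) (by positivity)).toJordanDecomposition.posPart.restrict
      (shell d k)

/-- The negative part `ν⁻`: the measure on the whole space that agrees on the Borel subsets of
`{x : |x| ≥ r}` with the negative part of the restriction of `ν`, for every `r > 0`, and has no
mass at `0`; see `negPart_apply` and `negPart_singleton_zero`. -/
def negPart : Measure (EuclideanSpace ℝ (Fin d)) :=
  Measure.sum fun k : ℕ =>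
    (ν.restrictFar (1 / ((k : ℝ) + 1)) (by positivity)).toJordanDecomposition.negPart.restrict
      (shell d k)

/-- `f` is integrable with respect to `ν` if it is so with respect to `ν⁺` and `ν⁻`. -/
def Integrable {F : Type*} [NormedAddCommGroup F] (f : EuclideanSpace ℝ (Fin d) → F) : Prop :=
  MeasureTheory.Integrable f ν.posPart ∧ MeasureTheory.Integrable f ν.negPart

/-- The integral `∫ f dν = ∫ f dν⁺ - ∫ f dν⁻`. -/
def integral {F : Type*} [NormedAddCommGroup F] [NormedSpace ℝ F]
    (f : EuclideanSpace ℝ (Fin d) → F) : F :=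
  ∫ x, f x ∂ν.posPart - ∫ x, f x ∂ν.negPart

/-- `ν` is a quasi-Lévy type measure: `x ↦ 1 ∧ |x|²` is integrable with respect to `ν`. -/
def IsQuasiLevyType : Prop :=
  ν.Integrable fun x => min (1 : ℝ) (‖x‖ ^ 2)

/-! Verification that `ν⁺` and `ν⁻` are as described. -/

theorem restrictFar_apply {r : ℝ} (hr : 0 < r) {B : Set (EuclideanSpace ℝ (Fin d))}
    (hB : MeasurableSet B) : ν.restrictFar r hr B = ν.measureOf (B ∩ far d r) :=
  if_pos hB

theorem restrictFar_parts {r s : ℝ} (hr : 0 < r) (hs : 0 < s) (hrs : r ≤ s) :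
    (ν.restrictFar s hs).toJordanDecomposition.posPart =
        (ν.restrictFar r hr).toJordanDecomposition.posPart.restrict (far d s) ∧
      (ν.restrictFar s hs).toJordanDecomposition.negPart =
        (ν.restrictFar r hr).toJordanDecomposition.negPart.restrict (far d s) := by
  set j := (ν.restrictFar r hr).toJordanDecomposition with hj
  let j' : JordanDecomposition (EuclideanSpace ℝ (Fin d)) :=
    { posPart := j.posPart.restrict (far d s)
      negPart := j.negPart.restrict (far d s)
      mutuallySingular := (j.mutuallySingular.restrict _).symm.restrict _ |>.symm }
  have key : ν.restrictFar s hs = j'.toSignedMeasure := by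
    ext B hB
    have hsub : far d s ⊆ far d r := fun x hx => le_trans hrs hx
    have h1 : (ν.restrictFar r hr) (B ∩ far d s) =
        j.posPart.real (B ∩ far d s) - j.negPart.real (B ∩ far d s) := by
      conv_lhs => rw [← SignedMeasure.toSignedMeasure_toJordanDecomposition (ν.restrictFar r hr)]
      rw [JordanDecomposition.toSignedMeasure,
        Measure.toSignedMeasure_sub_apply (hB.inter (measurableSet_far d s))]
    rw [ν.restrictFar_apply hr (hB.inter (measurableSet_far d s)), Set.inter_assoc,
      Set.inter_eq_left.2 hsub] at h1
    rw [ν.restrictFar_apply hs hB, h1, JordanDecomposition.toSignedMeasure,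
      Measure.toSignedMeasure_sub_apply hB]
    simp only [j', Measure.real, Measure.restrict_apply hB]
  rw [SignedMeasure.toJordanDecomposition_eq key]
  exact ⟨rfl, rfl⟩

theorem restrictFar_parts_apply {r s : ℝ} (hr : 0 < r) (hs : 0 < s)
    {B : Set (EuclideanSpace ℝ (Fin d))} (hBr : B ∈ borelFar d r) (hBs : B ∈ borelFar d s) :
    (ν.restrictFar s hs).toJordanDecomposition.posPart B =
        (ν.restrictFar r hr).toJordanDecomposition.posPart B ∧
      (ν.restrictFar s hs).toJordanDecomposition.negPart B =
        (ν.restrictFar r hr).toJordanDecomposition.negPart B := by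
  rcases le_total r s with h | h
  · obtain ⟨h1, h2⟩ := ν.restrictFar_parts hr hs h
    rw [h1, h2, Measure.restrict_apply hBr.1, Measure.restrict_apply hBr.1,
      Set.inter_eq_left.2 hBs.2]
    exact ⟨rfl, rfl⟩
  · obtain ⟨h1, h2⟩ := ν.restrictFar_parts hs hr h
    rw [h1, h2, Measure.restrict_apply hBr.1, Measure.restrict_apply hBr.1,
      Set.inter_eq_left.2 hBr.2]
    exact ⟨rfl, rfl⟩

theorem measurableSet_shell (k : ℕ) : MeasurableSet (shell d k) :=
  MeasurableSet.disjointed (fun _ => measurableSet_far d _) k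

theorem shell_subset (k : ℕ) : shell d k ⊆ far d (1 / ((k : ℝ) + 1)) :=
  disjointed_subset _ k

theorem iUnion_shell : ⋃ k, shell d k = {0}ᶜ := by
  ext x
  rw [shell, iUnion_disjointed]
  simp only [Set.mem_iUnion, far, Set.mem_ofPred_eq, Set.mem_compl_iff, Set.mem_singleton_iff]
  constructor
  · rintro ⟨k, hk⟩ rfl
    rw [norm_zero] at hk
    have : (0 : ℝ) < 1 / ((k : ℝ) + 1) := by positivity
    linarith
  · intro hx
    obtain ⟨k, hk⟩ := exists_nat_one_div_lt (norm_pos_iff.2 hx)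
    exact ⟨k, hk.le⟩

theorem sum_restrict_shell_apply (m : ℕ → Measure (EuclideanSpace ℝ (Fin d)))
    (ρ : Measure (EuclideanSpace ℝ (Fin d))) {r : ℝ} (hr : 0 < r)
    {B : Set (EuclideanSpace ℝ (Fin d))} (hB : B ∈ borelFar d r)
    (h : ∀ k, m k (B ∩ shell d k) = ρ (B ∩ shell d k)) :
    (Measure.sum fun k => (m k).restrict (shell d k)) B = ρ B := by
  have hB0 : B = ⋃ k, B ∩ shell d k := by
    rw [← Set.inter_iUnion, iUnion_shell, eq_comm, Set.inter_eq_left]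
    rintro x hx rfl
    have := hB.2 hx
    simp only [far, Set.mem_ofPred_eq, norm_zero] at this
    linarith
  rw [Measure.sum_apply _ hB.1]
  simp only [Measure.restrict_apply hB.1, h]
  conv_rhs => rw [hB0]
  rw [measure_iUnion _ (fun k => hB.1.inter (measurableSet_shell k))]
  intro i j hij
  exact (disjoint_disjointed (fun k : ℕ => far d (1 / ((k : ℝ) + 1))) hij).mono
    Set.inter_subset_right Set.inter_subset_right

theorem posPart_apply {r : ℝ} (hr : 0 < r) {B : Set (EuclideanSpace ℝ (Fin d))}
    (hB : B ∈ borelFar d r) :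
    ν.posPart B = (ν.restrictFar r hr).toJordanDecomposition.posPart B := by
  refine sum_restrict_shell_apply _ _ hr hB fun k => ?_
  have hm := hB.1.inter (measurableSet_shell (d := d) k)
  exact (ν.restrictFar_parts_apply hr (by positivity)
    ⟨hm, Set.inter_subset_left.trans hB.2⟩
    ⟨hm, Set.inter_subset_right.trans (shell_subset k)⟩).1

theorem negPart_apply {r : ℝ} (hr : 0 < r) {B : Set (EuclideanSpace ℝ (Fin d))}
    (hB : B ∈ borelFar d r) :
    ν.negPart B = (ν.restrictFar r hr).toJordanDecomposition.negPart B := by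
  refine sum_restrict_shell_apply _ _ hr hB fun k => ?_
  have hm := hB.1.inter (measurableSet_shell (d := d) k)
  exact (ν.restrictFar_parts_apply hr (by positivity)
    ⟨hm, Set.inter_subset_left.trans hB.2⟩
    ⟨hm, Set.inter_subset_right.trans (shell_subset k)⟩).2

theorem zero_notMem_shell (k : ℕ) : (0 : EuclideanSpace ℝ (Fin d)) ∉ shell d k := fun h => by
  have : (0 : EuclideanSpace ℝ (Fin d)) ∈ ⋃ k, shell d k := Set.mem_iUnion.2 ⟨k, h⟩
  rw [iUnion_shell] at this
  exact this rfl

theorem posPart_singleton_zero : ν.posPart {0} = 0 := by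
  rw [posPart, Measure.sum_apply _ (measurableSet_singleton 0)]
  simp [Measure.restrict_apply, zero_notMem_shell]

theorem negPart_singleton_zero : ν.negPart {0} = 0 := by
  rw [negPart, Measure.sum_apply _ (measurableSet_singleton 0)]
  simp [Measure.restrict_apply, zero_notMem_shell]

end SignedMeasureOffZero

/-! ### The Lévy–Khintchine type representation -/

/-- A representation function: bounded, Borel measurable and `|x|⁻² |c x - x| → 0` as `x → 0`. -/
structure IsRepresentationFunction {d : ℕ}
    (c : EuclideanSpace ℝ (Fin d) → EuclideanSpace ℝ (Fin d)) : Prop where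
  bounded : ∃ M : ℝ, ∀ x, ‖c x‖ ≤ M
  measurable : Measurable c
  tendsto : Tendsto (fun x => (‖x‖ ^ 2)⁻¹ * ‖c x - x‖) (𝓝[≠] 0) (𝓝 0)

/-- The quadratic form `⟨z, A z⟩`. -/
def quadForm {d : ℕ} (A : Matrix (Fin d) (Fin d) ℝ) (z : EuclideanSpace ℝ (Fin d)) : ℝ :=
  ⟪z, Matrix.toEuclideanLin A z⟫

/-- The function
`Ψ(z) = i⟨γ,z⟩ - ½⟨z,Az⟩ + ∫ (exp(i⟨z,x⟩) - 1 - i⟨z,c(x)⟩) ν(dx)`. -/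
def characteristicExponent {d : ℕ} (c : EuclideanSpace ℝ (Fin d) → EuclideanSpace ℝ (Fin d))
    (A : Matrix (Fin d) (Fin d) ℝ) (ν : SignedMeasureOffZero d) (γ : EuclideanSpace ℝ (Fin d))
    (z : EuclideanSpace ℝ (Fin d)) : ℂ :=
  Complex.I * (⟪γ, z⟫ : ℝ) - 1 / 2 * (quadForm A z : ℝ)
    + ν.integral fun x =>
        Complex.exp (Complex.I * (⟪z, x⟫ : ℝ)) - 1 - Complex.I * (⟪z, c x⟫ : ℝ)

/-- `μ` is quasi-infinitely divisible with characteristic triplet `(A, ν, γ)` with respect to the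
representation function `c`. -/
structure HasCharacteristicTriplet {d : ℕ}
    (c : EuclideanSpace ℝ (Fin d) → EuclideanSpace ℝ (Fin d))
    (μ : ProbabilityMeasure (EuclideanSpace ℝ (Fin d)))
    (A : Matrix (Fin d) (Fin d) ℝ) (ν : SignedMeasureOffZero d)
    (γ : EuclideanSpace ℝ (Fin d)) : Prop where
  isQuasiInfinitelyDivisible : IsQuasiInfinitelyDivisible μ
  isSymm : A.IsSymm
  isQuasiLevyType : ν.IsQuasiLevyType
  charFun_eq : ∀ z : EuclideanSpace ℝ (Fin d),
    charFun (μ : Measure (EuclideanSpace ℝ (Fin d))) z =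
      Complex.exp (characteristicExponent c A ν γ z)

/-! ### Notions in the convergence criterion -/

/-- The class `C_#` of bounded continuous real functions vanishing on a neighbourhood of `0`. -/
def cSharp (d : ℕ) : Set (EuclideanSpace ℝ (Fin d) →ᵇ ℝ) :=
  {f | ∃ U ∈ 𝓝 (0 : EuclideanSpace ℝ (Fin d)), ∀ x ∈ U, f x = 0}

/-- The quadratic form `⟨z, A_ε z⟩ = ⟨z, A z⟩ + ∫_{|x| ≤ ε} ⟨z, x⟩² ν⁺(dx)`. -/
def truncatedQuadForm {d : ℕ} (A : Matrix (Fin d) (Fin d) ℝ) (ν : SignedMeasureOffZero d)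
    (ε : ℝ) (z : EuclideanSpace ℝ (Fin d)) : ℝ :=
  quadForm A z + ∫ x in {x : EuclideanSpace ℝ (Fin d) | ‖x‖ ≤ ε}, ⟪z, x⟫ ^ 2 ∂ν.posPart

end QID

end

/-! By Lévy's continuity theorem it is enough that the exponents `Ψ_n(z)` converge to `Ψ(z)` for
each fixed `z`; since `exp` is continuous, no logarithm of a characteristic function has to be
chosen.

Let `g(x) = exp(i⟨z,x⟩) - 1 - i⟨z,c(x)⟩` and let `χ_ε` be a continuous cutoff supported in `|x| ≤
ε`. The real and imaginary parts of `(1 - χ_ε) g` lie in `C_#`, so the far integrals against `ν_n^±`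
converge for fixed `ε`. Near the origin `|g| ≤ C|x|²`, so the `ν_n^-` part is small by the smallness
condition on `ν_n^-`. For `ν_n^+`, write `g = -⟨z,x⟩²/2 + o(|x|²)`. The quadratic term joins the
Gaussian part, and `⟨z,A_n z⟩ + ∫ χ_ε ⟨z,x⟩² dν_n^+` lies between the truncated forms at `ε/2` and
`ε`, both close to `⟨z,Az⟩`. The remainder is negligible once `∫_{|x|≤ε} |x|² dν_n^+` is bounded
uniformly in `n` (`exists_lintegral_norm_sq_le`).

That bound comes from summing the truncated forms over an orthonormal basis and dropping the
Gaussian terms, which requires `A_n` to be nonnegative definite. This is not part of the definition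
of a triplet; `HasCharacteristicTriplet.quadForm_nonneg` derives it from `|charFun| ≤ 1`. Everything
is assembled in `tendsto_characteristicExponent`. -/

noncomputable section

namespace QID

variable {d : ℕ}

local notation "𝔼" => EuclideanSpace ℝ (Fin d)

/-! ### The integrand of the Lévy–Khintchine representation -/

/-- The integrand `exp(i⟨z,x⟩) - 1 - i⟨z,c(x)⟩`. -/
def levyKernel (c : 𝔼 → 𝔼) (z x : 𝔼) : ℂ :=
  Complex.exp (Complex.I * (⟪z, x⟫ : ℝ)) - 1 - Complex.I * (⟪z, c x⟫ : ℝ)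

theorem IsRepresentationFunction.sub_isLittleO {c : 𝔼 → 𝔼} (hc : IsRepresentationFunction c)
    (hcont : Continuous c) : (fun x => c x - x) =o[𝓝 0] fun x => ‖x‖ ^ 2 := by
  have h : (fun x => c x - x) =o[𝓝[≠] 0] fun x => ‖x‖ ^ 2 := by
    rw [Asymptotics.isLittleO_iff]
    intro ε hε
    filter_upwards [(tendsto_order.1 hc.tendsto).2 ε hε, self_mem_nhdsWithin] with x hx hx0
    have hpos : 0 < ‖x‖ ^ 2 := by have := norm_pos_iff.2 hx0; positivity
    rw [inv_mul_lt_iff₀ hpos] at hx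
    rw [Real.norm_of_nonneg hpos.le]
    linarith
  -- The defining limit ignores the value at `0`; continuity forces `c 0 = 0`. In dimension `0` the
  -- punctured neighbourhood filter is trivial and limits are not unique, so that case is treated
  -- separately.
  have h0 : c 0 - 0 = 0 := by
    have h1 : Tendsto (fun x => c x - x) (𝓝[≠] 0) (𝓝 (c 0 - 0)) :=
      ((hcont.sub continuous_id).tendsto 0).mono_left nhdsWithin_le_nhds
    have h2 : Tendsto (fun x => c x - x) (𝓝[≠] 0) (𝓝 0) := by
      refine h.trans_tendsto ?_
      have : Continuous fun x : 𝔼 => ‖x‖ ^ 2 := by fun_prop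
      simpa using (this.tendsto 0).mono_left (nhdsWithin_le_nhds (s := {0}ᶜ))
    rcases (𝓝[≠] (0 : 𝔼)).eq_or_neBot with hbot | hne
    · have : ({0} : Set 𝔼) ∈ 𝓝 0 := by
        rw [← nhdsNE_sup_pure, hbot, bot_sup_eq]; simp
      have hs : Subsingleton 𝔼 := by
        by_contra hns
        rw [not_subsingleton_iff_nontrivial] at hns
        exact (Module.punctured_nhds_neBot ℝ 𝔼 0).ne hbot
      exact Subsingleton.elim _ _
    · exact tendsto_nhds_unique h1 h2
  rw [← nhdsNE_sup_pure, Asymptotics.isLittleO_sup]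
  exact ⟨h, by rw [Asymptotics.isLittleO_pure]; simpa using h0⟩

/-- Second-order Taylor expansion of `exp` at `i⟨z,x⟩`; exchanging the linear term `i⟨z,x⟩` for
`i⟨z,c x⟩` costs `i⟨z,c x - x⟩`, again `o(|x|²)`. -/
theorem levyKernel_add_sq_isLittleO {c : 𝔼 → 𝔼} (hc : IsRepresentationFunction c)
    (hcont : Continuous c) (z : 𝔼) :
    (fun x => levyKernel c z x + ((⟪z, x⟫ ^ 2 / 2 : ℝ) : ℂ)) =o[𝓝 0] fun x => ‖x‖ ^ 2 := by
  have hlin : (fun x : 𝔼 => Complex.I * ((⟪z, x⟫ : ℝ) : ℂ)) =O[𝓝 0] fun x => ‖x‖ := by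
    refine Asymptotics.IsBigO.of_bound ‖z‖ (Eventually.of_forall fun x => ?_)
    simpa using abs_real_inner_le_norm z x
  have ht : Tendsto (fun x : 𝔼 => Complex.I * ((⟪z, x⟫ : ℝ) : ℂ)) (𝓝 0) (𝓝 0) := by
    have : Continuous (fun x : 𝔼 => Complex.I * ((⟪z, x⟫ : ℝ) : ℂ)) := by fun_prop
    simpa using this.tendsto 0
  have h1 := ((Complex.exp_sub_sum_range_succ_isLittleO_pow 2).comp_tendsto ht).trans_isBigO
    (hlin.pow 2)
  have h2 : (fun x : 𝔼 => Complex.I * ((⟪z, c x - x⟫ : ℝ) : ℂ)) =o[𝓝 0] fun x => ‖x‖ ^ 2 := by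
    refine Asymptotics.IsBigO.trans_isLittleO ?_ (hc.sub_isLittleO hcont)
    refine Asymptotics.IsBigO.of_bound ‖z‖ (Eventually.of_forall fun x => ?_)
    simpa only [norm_mul, Complex.norm_I, one_mul, Complex.norm_real, Real.norm_eq_abs] using
      abs_real_inner_le_norm z (c x - x)
  refine (h1.sub h2).congr_left fun x => ?_
  simp only [levyKernel, Function.comp_apply, Finset.sum_range_succ, Finset.sum_range_zero,
    inner_sub_right, mul_pow, Complex.I_sq]
  push_cast
  simp
  ring

theorem continuous_levyKernel {c : 𝔼 → 𝔼} (hcont : Continuous c) (z : 𝔼) :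
    Continuous (levyKernel c z) := by
  unfold levyKernel
  fun_prop

theorem exists_norm_levyKernel_le {c : 𝔼 → 𝔼} (hc : IsRepresentationFunction c)
    (hcont : Continuous c) (z : 𝔼) :
    ∃ C, 0 ≤ C ∧ ∀ x, ‖levyKernel c z x‖ ≤ C * min 1 (‖x‖ ^ 2) := by
  obtain ⟨M, hM⟩ := hc.bounded
  have hM0 : 0 ≤ M := (norm_nonneg _).trans (hM 0)
  have hb : ∀ x, ‖levyKernel c z x‖ ≤ 2 + ‖z‖ * M := fun x => by
    have h1 : ‖Complex.exp (Complex.I * (⟪z, x⟫ : ℝ))‖ = 1 := by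
      rw [mul_comm]; exact Complex.norm_exp_ofReal_mul_I _
    have h2 : ‖Complex.I * ((⟪z, c x⟫ : ℝ) : ℂ)‖ ≤ ‖z‖ * M := by
      simp only [norm_mul, Complex.norm_I, one_mul, Complex.norm_real, Real.norm_eq_abs]
      exact (abs_real_inner_le_norm _ _).trans (by gcongr; exact hM x)
    calc _ ≤ ‖Complex.exp (Complex.I * (⟪z, x⟫ : ℝ))‖ + ‖(1 : ℂ)‖ + ‖z‖ * M :=
          (norm_sub_le _ _).trans (add_le_add (norm_sub_le _ _) h2)
      _ = _ := by rw [h1, norm_one]; ring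
  have hO : levyKernel c z =O[𝓝 0] fun x => ‖x‖ ^ 2 := by
    have h1 := (levyKernel_add_sq_isLittleO hc hcont z).isBigO
    have h2 : (fun x : 𝔼 => ((⟪z, x⟫ ^ 2 / 2 : ℝ) : ℂ)) =O[𝓝 0] fun x => ‖x‖ ^ 2 := by
      refine Asymptotics.IsBigO.of_bound (‖z‖ ^ 2 / 2) (Eventually.of_forall fun x => ?_)
      rw [Complex.norm_real, Real.norm_of_nonneg (by positivity),
        Real.norm_of_nonneg (by positivity), ← sq_abs]
      have := pow_le_pow_left₀ (abs_nonneg _) (abs_real_inner_le_norm z x) 2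
      linarith
    simpa using h1.sub h2
  obtain ⟨K, hK⟩ := hO.bound
  obtain ⟨r, hr, hball⟩ := Metric.eventually_nhds_iff.1 hK
  -- The three summands serve `|x| < r`, `|x| ≥ 1` and the annulus `r ≤ |x| ≤ 1`, where the uniform
  -- bound is traded for a multiple of `|x|²`.
  refine ⟨max K 0 + (2 + ‖z‖ * M) + (2 + ‖z‖ * M) / r ^ 2, by positivity, fun x => ?_⟩
  have hB : 0 ≤ 2 + ‖z‖ * M := by positivity
  have hD : 0 ≤ (2 + ‖z‖ * M) / r ^ 2 := by positivity
  rcases le_total 1 (‖x‖ ^ 2) with h | h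
  · rw [min_eq_left h]
    linarith [hb x, le_max_right K 0]
  · rw [min_eq_right h]
    rcases lt_or_ge ‖x‖ r with h' | h'
    · have := hball (y := x) (by simpa using h')
      rw [Real.norm_of_nonneg (by positivity)] at this
      refine this.trans (mul_le_mul_of_nonneg_right ?_ (by positivity))
      linarith [le_max_left K 0]
    · calc _ ≤ 2 + ‖z‖ * M := hb x
        _ = (2 + ‖z‖ * M) / r ^ 2 * r ^ 2 := by field_simp
        _ ≤ (2 + ‖z‖ * M) / r ^ 2 * ‖x‖ ^ 2 := by gcongr
        _ ≤ _ := by gcongr; linarith [le_max_right K 0]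

theorem integrable_of_norm_le_min {F : Type*} [NormedAddCommGroup F] {m : Measure 𝔼}
    (hm : Integrable (fun x => min (1 : ℝ) (‖x‖ ^ 2)) m) {f : 𝔼 → F}
    (hf : AEStronglyMeasurable f m) (C : ℝ) (h : ∀ x, ‖f x‖ ≤ C * min 1 (‖x‖ ^ 2)) :
    Integrable f m :=
  (hm.const_mul C).mono' hf (Eventually.of_forall h)

theorem integrable_levyKernel {c : 𝔼 → 𝔼} (hc : IsRepresentationFunction c)
    (hcont : Continuous c) {m : Measure 𝔼}
    (hm : Integrable (fun x => min (1 : ℝ) (‖x‖ ^ 2)) m) (z : 𝔼) :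
    Integrable (levyKernel c z) m := by
  obtain ⟨C, -, hC⟩ := exists_norm_levyKernel_le hc hcont z
  exact integrable_of_norm_le_min hm (continuous_levyKernel hcont z).aestronglyMeasurable C hC

/-! ### The Gaussian part is nonnegative definite -/

theorem levyKernel_re (c : 𝔼 → 𝔼) (z x : 𝔼) :
    (levyKernel c z x).re = Real.cos ⟪z, x⟫ - 1 := by
  simp [levyKernel, Complex.exp_re]

theorem abs_one_sub_cos_le (u : ℝ) : |Real.cos u - 1| ≤ 2 * min 1 (u ^ 2) := by
  rw [abs_of_nonpos (by linarith [Real.cos_le_one u]), mul_min_of_nonneg _ _ zero_le_two]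
  refine le_min ?_ ?_
  · linarith [Real.neg_one_le_cos u]
  · nlinarith [Real.one_sub_sq_div_two_le_cos (x := u)]

theorem tendsto_integral_cos_sub_one_div_sq {m : Measure 𝔼}
    (hm : Integrable (fun x => min (1 : ℝ) (‖x‖ ^ 2)) m) (z : 𝔼) :
    Tendsto (fun t : ℝ => ∫ x, (t ^ 2)⁻¹ * (Real.cos (t * ⟪z, x⟫) - 1) ∂m) atTop (𝓝 0) := by
  rw [← integral_zero 𝔼 ℝ (μ := m)]
  -- A dominating function independent of `t`: for `t ≥ 1`, `t⁻² min(1, t²u²) ≤ min(1, u²)`.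
  have hbd : ∀ t : ℝ, 1 ≤ t → ∀ u : ℝ,
      ‖(t ^ 2)⁻¹ * (Real.cos (t * u) - 1)‖ ≤ 2 * min 1 (u ^ 2) := fun t ht u => by
    have ht2 : 1 ≤ t ^ 2 := one_le_pow₀ ht
    rw [norm_mul, Real.norm_of_nonneg (by positivity), inv_mul_le_iff₀ (by positivity)]
    refine (abs_one_sub_cos_le _).trans ?_
    rw [mul_left_comm]
    refine mul_le_mul_of_nonneg_left ?_ zero_le_two
    rw [mul_min_of_nonneg _ _ (by positivity), mul_pow, mul_one]
    exact min_le_min_right _ ht2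
  refine tendsto_integral_filter_of_dominated_convergence
    (fun x => 2 * (1 + ‖z‖ ^ 2) * min 1 (‖x‖ ^ 2)) ?_ ?_ (hm.const_mul _) ?_
  · exact Eventually.of_forall fun t => Continuous.aestronglyMeasurable (by fun_prop)
  · filter_upwards [eventually_ge_atTop 1] with t ht
    refine Eventually.of_forall fun x => (hbd t ht _).trans ?_
    rw [mul_assoc]
    refine mul_le_mul_of_nonneg_left ?_ zero_le_two
    rw [mul_min_of_nonneg _ _ (by positivity)]
    refine min_le_min (by nlinarith [sq_nonneg ‖z‖]) ?_
    have := pow_le_pow_left₀ (abs_nonneg _) (abs_real_inner_le_norm z x) 2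
    rw [sq_abs] at this
    nlinarith [sq_nonneg ‖x‖]
  · refine Eventually.of_forall fun x => squeeze_zero_norm' (a := fun t : ℝ => (t ^ 2)⁻¹ * 2) ?_ ?_
    · refine Eventually.of_forall fun t => ?_
      rw [norm_mul, Real.norm_of_nonneg (by positivity)]
      gcongr
      exact (abs_one_sub_cos_le _).trans (by linarith [min_le_left (1 : ℝ) ((t * ⟪z, x⟫) ^ 2)])
    · simpa using (tendsto_inv_atTop_zero.comp
        (tendsto_pow_atTop (α := ℝ) two_ne_zero)).mul_const 2

theorem quadForm_smul (A : Matrix (Fin d) (Fin d) ℝ) (t : ℝ) (z : 𝔼) :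
    quadForm A (t • z) = t ^ 2 * quadForm A z := by
  simp only [quadForm, map_smul, real_inner_smul_left, real_inner_smul_right]
  ring

theorem characteristicExponent_re {c : 𝔼 → 𝔼} (hc : IsRepresentationFunction c)
    (hcont : Continuous c) (A : Matrix (Fin d) (Fin d) ℝ) {ν : SignedMeasureOffZero d}
    (hν : ν.IsQuasiLevyType) (γ z : 𝔼) :
    (characteristicExponent c A ν γ z).re = -(1 / 2) * quadForm A z +
      (∫ x, (Real.cos ⟪z, x⟫ - 1) ∂ν.posPart - ∫ x, (Real.cos ⟪z, x⟫ - 1) ∂ν.negPart) := by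
  have h : ∀ m : Measure 𝔼, Integrable (fun x => min (1 : ℝ) (‖x‖ ^ 2)) m →
      (∫ x, levyKernel c z x ∂m).re = ∫ x, (Real.cos ⟪z, x⟫ - 1) ∂m := fun m hm => by
    have := integral_re (integrable_levyKernel hc hcont hm z)
    simp only [RCLike.re_to_complex, levyKernel_re] at this
    exact this.symm
  have h1 := h _ hν.1
  have h2 := h _ hν.2
  simp only [levyKernel] at h1 h2
  simp only [characteristicExponent, SignedMeasureOffZero.integral, Complex.add_re,
    Complex.sub_re, h1, h2]
  simp

/-- Since `|charFun| ≤ 1`, the exponent has nonpositive real part. Evaluate it at `t z` and divide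
by `t²`: the Gaussian term stays constant while the integrals against `ν⁺` and `ν⁻` vanish as `t →
∞`. -/
theorem HasCharacteristicTriplet.quadForm_nonneg {c : 𝔼 → 𝔼} (hc : IsRepresentationFunction c)
    (hcont : Continuous c) {μ : ProbabilityMeasure 𝔼} {A : Matrix (Fin d) (Fin d) ℝ}
    {ν : SignedMeasureOffZero d} {γ : 𝔼} (h : HasCharacteristicTriplet c μ A ν γ) (z : 𝔼) :
    0 ≤ quadForm A z := by
  have hν := h.isQuasiLevyType
  have hre : ∀ w : 𝔼, (characteristicExponent c A ν γ w).re ≤ 0 := fun w => by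
    have h1 := norm_charFun_le_one (μ := (μ : Measure 𝔼)) (t := w)
    rwa [h.charFun_eq, Complex.norm_exp, Real.exp_le_one_iff] at h1
  have hlim : Tendsto (fun t : ℝ =>
      (∫ x, (t ^ 2)⁻¹ * (Real.cos (t * ⟪z, x⟫) - 1) ∂ν.posPart -
        ∫ x, (t ^ 2)⁻¹ * (Real.cos (t * ⟪z, x⟫) - 1) ∂ν.negPart)) atTop (𝓝 (0 - 0)) :=
    (tendsto_integral_cos_sub_one_div_sq hν.1 z).sub (tendsto_integral_cos_sub_one_div_sq hν.2 z)
  have hle : (0 : ℝ) - 0 ≤ 1 / 2 * quadForm A z := by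
    refine le_of_tendsto hlim ?_
    filter_upwards [eventually_gt_atTop 0] with t ht
    have h1 := hre (t • z)
    rw [characteristicExponent_re hc hcont A hν, quadForm_smul] at h1
    simp only [real_inner_smul_left] at h1
    rw [integral_const_mul, integral_const_mul, ← mul_sub, inv_mul_le_iff₀ (by positivity)]
    linarith
  linarith

/-! ### A continuous cutoff near the origin -/

/-- A continuous function equal to `1` for `|x| ≤ ε / 2` and to `0` for `|x| ≥ ε`. -/
def nearCutoff (ε : ℝ) (x : 𝔼) : ℝ :=
  max 0 (min 1 (2 - 2 * ‖x‖ / ε))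

theorem continuous_nearCutoff (ε : ℝ) : Continuous (nearCutoff ε : 𝔼 → ℝ) := by
  unfold nearCutoff
  fun_prop

theorem nearCutoff_nonneg (ε : ℝ) (x : 𝔼) : 0 ≤ nearCutoff ε x := le_max_left _ _

theorem nearCutoff_le_one (ε : ℝ) (x : 𝔼) : nearCutoff ε x ≤ 1 :=
  max_le zero_le_one (min_le_left _ _)

theorem nearCutoff_eq_one {ε : ℝ} (hε : 0 < ε) {x : 𝔼} (hx : ‖x‖ ≤ ε / 2) :
    nearCutoff ε x = 1 := by
  have : 2 * ‖x‖ / ε ≤ 1 := by rw [div_le_one hε]; linarith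
  rw [nearCutoff, min_eq_left (by linarith), max_eq_right zero_le_one]

theorem nearCutoff_eq_zero {ε : ℝ} (hε : 0 < ε) {x : 𝔼} (hx : ε ≤ ‖x‖) :
    nearCutoff ε x = 0 := by
  have : 2 ≤ 2 * ‖x‖ / ε := by rw [le_div_iff₀ hε]; linarith
  rw [nearCutoff, max_eq_left]
  exact (min_le_right _ _).trans (by linarith)

theorem measurableSet_norm_le (ε : ℝ) : MeasurableSet {x : 𝔼 | ‖x‖ ≤ ε} :=
  measurableSet_le measurable_norm measurable_const

/-- Working in `[0,∞]` avoids any integrability requirement and matches the form of the smallness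
condition on `ν_n^-`. -/
theorem enorm_integral_nearCutoff_mul_le (m : Measure 𝔼) {ε K : ℝ} (hε : 0 < ε) {h : 𝔼 → ℂ}
    (hh : ∀ x, ‖x‖ ≤ ε → ‖h x‖ ≤ K * ‖x‖ ^ 2) :
    ‖∫ x, (nearCutoff ε x : ℂ) * h x ∂m‖ₑ ≤
      ENNReal.ofReal K * ∫⁻ x in {x : 𝔼 | ‖x‖ ≤ ε}, ENNReal.ofReal (‖x‖ ^ 2) ∂m := by
  refine (enorm_integral_le_lintegral_enorm _).trans ?_
  rw [← lintegral_const_mul _ (by fun_prop), ← lintegral_indicator (measurableSet_norm_le ε)]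
  refine lintegral_mono fun x => ?_
  by_cases hx : ‖x‖ ≤ ε
  · rw [indicator_of_mem (show x ∈ {x : 𝔼 | ‖x‖ ≤ ε} from hx), ← ofReal_norm,
      ← ENNReal.ofReal_mul' (by positivity)]
    refine ENNReal.ofReal_le_ofReal ?_
    rw [norm_mul, Complex.norm_real, Real.norm_of_nonneg (nearCutoff_nonneg _ _)]
    exact (mul_le_of_le_one_left (norm_nonneg _) (nearCutoff_le_one _ _)).trans (hh x hx)
  · simp [nearCutoff_eq_zero hε (not_le.1 hx).le]

theorem integrable_nearCutoff_mul {m : Measure 𝔼} {h : 𝔼 → ℂ} (hm : Integrable h m) (ε : ℝ) :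
    Integrable (fun x => (nearCutoff ε x : ℂ) * h x) m := by
  refine hm.bdd_mul (c := 1) ?_ (Eventually.of_forall fun x => ?_)
  · exact (Complex.continuous_ofReal.comp (continuous_nearCutoff ε)).aestronglyMeasurable
  · rw [Complex.norm_real, Real.norm_of_nonneg (nearCutoff_nonneg _ _)]
    exact nearCutoff_le_one _ _

/-- As `ε ↓ 0` the cutoffs decrease to the indicator of `{0}`, where `h` vanishes. This handles the
fixed limit `ν`; for `ν_n` uniformity in `n` is needed and comes from the moment bounds. -/
theorem tendsto_integral_nearCutoff_mul {m : Measure 𝔼} {h : 𝔼 → ℂ} (hm : Integrable h m)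
    (h0 : h 0 = 0) :
    Tendsto (fun ε => ∫ x, (nearCutoff ε x : ℂ) * h x ∂m) (𝓝[>] 0) (𝓝 0) := by
  rw [← integral_zero 𝔼 ℂ (μ := m)]
  refine tendsto_integral_filter_of_dominated_convergence (fun x => ‖h x‖) ?_ ?_ hm.norm ?_
  · exact Eventually.of_forall fun ε => (integrable_nearCutoff_mul hm ε).aestronglyMeasurable
  · refine Eventually.of_forall fun ε => Eventually.of_forall fun x => ?_
    rw [norm_mul, Complex.norm_real, Real.norm_of_nonneg (nearCutoff_nonneg _ _)]
    exact mul_le_of_le_one_left (norm_nonneg _) (nearCutoff_le_one _ _)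
  · refine Eventually.of_forall fun x => ?_
    rcases eq_or_ne x 0 with rfl | hx
    · simp [h0]
    · refine tendsto_const_nhds.congr' ?_
      filter_upwards [Ioo_mem_nhdsGT (norm_pos_iff.2 hx)] with ε hε
      simp [nearCutoff_eq_zero hε.1 hε.2.le]

/-- Convergence on `C_#` extends to bounded continuous complex functions multiplied by the
complementary cutoff. -/
theorem tendsto_integral_one_sub_nearCutoff_mul {m : ℕ → Measure 𝔼} {m' : Measure 𝔼}
    (hm : ∀ n, Integrable (fun x => min (1 : ℝ) (‖x‖ ^ 2)) (m n))
    (hm' : Integrable (fun x => min (1 : ℝ) (‖x‖ ^ 2)) m')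
    (hconv : ∀ f ∈ cSharp d, Tendsto (fun n => ∫ x, f x ∂(m n)) atTop (𝓝 (∫ x, f x ∂m')))
    {g : 𝔼 → ℂ} (hg : Continuous g) {C : ℝ} (hC : ∀ x, ‖g x‖ ≤ C * min 1 (‖x‖ ^ 2))
    (hC0 : 0 ≤ C) {ε : ℝ} (hε : 0 < ε) :
    Tendsto (fun n => ∫ x, ((1 - nearCutoff ε x : ℝ) : ℂ) * g x ∂(m n)) atTop
      (𝓝 (∫ x, ((1 - nearCutoff ε x : ℝ) : ℂ) * g x ∂m')) := by
  set G : 𝔼 → ℂ := fun x => ((1 - nearCutoff ε x : ℝ) : ℂ) * g x with hG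
  have hGc : Continuous G := by
    have := continuous_nearCutoff (d := d) ε
    fun_prop
  have hGg : ∀ x, ‖G x‖ ≤ C * min 1 (‖x‖ ^ 2) := fun x => by
    have h1 := nearCutoff_nonneg ε x
    have h2 := nearCutoff_le_one ε x
    rw [hG, norm_mul, Complex.norm_real, Real.norm_of_nonneg (by linarith)]
    exact (mul_le_of_le_one_left (norm_nonneg _) (by linarith)).trans (hC x)
  have hGb : ∀ x, ‖G x‖ ≤ C := fun x =>
    (hGg x).trans (mul_le_of_le_one_right hC0 (min_le_left _ _))
  have hG0 : ∀ x ∈ Metric.ball (0 : 𝔼) (ε / 2), G x = 0 := fun x hx => by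
    rw [mem_ball_zero_iff] at hx
    simp [hG, nearCutoff_eq_one hε hx.le]
  have hint : ∀ m : Measure 𝔼, Integrable (fun x => min (1 : ℝ) (‖x‖ ^ 2)) m →
      Integrable G m := fun m h => integrable_of_norm_le_min h hGc.aestronglyMeasurable C hGg
  -- `C_#` contains real functions only, so real and imaginary parts are passed to the limit
  -- separately.
  have key : ∀ m : Measure 𝔼, Integrable (fun x => min (1 : ℝ) (‖x‖ ^ 2)) m →
      ∫ x, G x ∂m = ((∫ x, (G x).re ∂m : ℝ) : ℂ) + ((∫ x, (G x).im ∂m : ℝ) : ℂ) * Complex.I :=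
    fun m h => (integral_re_add_im (hint m h)).symm
  have hball : Metric.ball (0 : 𝔼) (ε / 2) ∈ 𝓝 0 := Metric.ball_mem_nhds _ (half_pos hε)
  have hre := hconv (BoundedContinuousFunction.ofNormedAddCommGroup (fun x => (G x).re)
    (Complex.continuous_re.comp hGc) C fun x => (Complex.abs_re_le_norm _).trans (hGb x))
    ⟨_, hball, fun x hx => by simp [hG0 x hx]⟩
  have him := hconv (BoundedContinuousFunction.ofNormedAddCommGroup (fun x => (G x).im)
    (Complex.continuous_im.comp hGc) C fun x => (Complex.abs_im_le_norm _).trans (hGb x))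
    ⟨_, hball, fun x hx => by simp [hG0 x hx]⟩
  simp only [BoundedContinuousFunction.coe_ofNormedAddCommGroup] at hre him
  rw [key m' hm']
  simp only [fun n => key (m n) (hm n)]
  exact ((Complex.continuous_ofReal.tendsto _).comp hre).add
    (((Complex.continuous_ofReal.tendsto _).comp him).mul_const _)

/-! ### Comparison with the truncated quadratic form -/

theorem integrableOn_norm_sq {m : Measure 𝔼}
    (hm : Integrable (fun x => min (1 : ℝ) (‖x‖ ^ 2)) m) (ε : ℝ) :
    IntegrableOn (fun x => ‖x‖ ^ 2) {x : 𝔼 | ‖x‖ ≤ ε} m := by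
  refine Integrable.mono' ((hm.const_mul (1 + ε ^ 2)).integrableOn)
    (Continuous.aestronglyMeasurable (by fun_prop))
    ((ae_restrict_iff' (measurableSet_norm_le ε)).2 (Eventually.of_forall fun x hx => ?_))
  have hx' : ‖x‖ ^ 2 ≤ ε ^ 2 := pow_le_pow_left₀ (norm_nonneg x) hx 2
  rw [Real.norm_of_nonneg (by positivity), mul_min_of_nonneg _ _ (by positivity)]
  exact le_min (by linarith) (by nlinarith [sq_nonneg ‖x‖, sq_nonneg ε])

theorem integrableOn_inner_sq {m : Measure 𝔼}
    (hm : Integrable (fun x => min (1 : ℝ) (‖x‖ ^ 2)) m) (ε : ℝ) (z : 𝔼) :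
    IntegrableOn (fun x => ⟪z, x⟫ ^ 2) {x : 𝔼 | ‖x‖ ≤ ε} m := by
  refine Integrable.mono' ((integrableOn_norm_sq hm ε).const_mul (‖z‖ ^ 2))
    (Continuous.aestronglyMeasurable (by fun_prop)) (Eventually.of_forall fun x => ?_)
  rw [Real.norm_of_nonneg (by positivity), ← mul_pow, ← sq_abs]
  exact pow_le_pow_left₀ (abs_nonneg _) (abs_real_inner_le_norm z x) 2

theorem integrable_nearCutoff_mul_inner_sq {m : Measure 𝔼}
    (hm : Integrable (fun x => min (1 : ℝ) (‖x‖ ^ 2)) m) {ε : ℝ} (hε : 0 < ε) (z : 𝔼) :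
    Integrable (fun x => nearCutoff ε x * ⟪z, x⟫ ^ 2) m := by
  have h := (integrableOn_inner_sq hm ε z).integrable_indicator (measurableSet_norm_le ε)
  refine h.mono' (((continuous_nearCutoff ε).mul (by fun_prop)).aestronglyMeasurable)
    (Eventually.of_forall fun x => ?_)
  have h1 := nearCutoff_nonneg ε x
  rw [Real.norm_of_nonneg (by positivity)]
  by_cases hx : ‖x‖ ≤ ε
  · rw [indicator_of_mem (show x ∈ {x : 𝔼 | ‖x‖ ≤ ε} from hx)]
    exact mul_le_of_le_one_left (by positivity) (nearCutoff_le_one _ _)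
  · simp [nearCutoff_eq_zero hε (not_le.1 hx).le, Set.indicator, hx]

/-- Reconciles the continuous cutoff needed for `C_#` with the sharp truncation in the Gaussian
condition: the cutoff lies between the indicators of the balls of radius `ε/2` and `ε`. -/
theorem integral_nearCutoff_mul_inner_sq_mem {m : Measure 𝔼}
    (hm : Integrable (fun x => min (1 : ℝ) (‖x‖ ^ 2)) m) {ε : ℝ} (hε : 0 < ε) (z : 𝔼) :
    ∫ x, nearCutoff ε x * ⟪z, x⟫ ^ 2 ∂m ∈
      Set.Icc (∫ x in {x : 𝔼 | ‖x‖ ≤ ε / 2}, ⟪z, x⟫ ^ 2 ∂m)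
        (∫ x in {x : 𝔼 | ‖x‖ ≤ ε}, ⟪z, x⟫ ^ 2 ∂m) := by
  rw [← integral_indicator (measurableSet_norm_le _), ← integral_indicator (measurableSet_norm_le _)]
  constructor
  · refine integral_mono
      ((integrableOn_inner_sq hm _ z).integrable_indicator (measurableSet_norm_le _))
      (integrable_nearCutoff_mul_inner_sq hm hε z) fun x => ?_
    by_cases hx : ‖x‖ ≤ ε / 2
    · simp [nearCutoff_eq_one hε hx, Set.indicator, hx]
    · have h1 := nearCutoff_nonneg ε x
      simp only [Set.indicator, mem_ofPred_eq, hx, if_false]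
      positivity
  · refine integral_mono (integrable_nearCutoff_mul_inner_sq hm hε z)
      ((integrableOn_inner_sq hm _ z).integrable_indicator (measurableSet_norm_le _)) fun x => ?_
    by_cases hx : ‖x‖ ≤ ε
    · simp only [Set.indicator, mem_ofPred_eq, hx, if_true]
      exact mul_le_of_le_one_left (by positivity) (nearCutoff_le_one _ _)
    · simp [nearCutoff_eq_zero hε (not_le.1 hx).le, Set.indicator, hx]

/-- Expand `|x|² = ∑ ⟨e_i,x⟩²` and discard the nonnegative Gaussian terms. -/
theorem integral_norm_sq_le_sum_truncatedQuadForm {A : Matrix (Fin d) (Fin d) ℝ}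
    {ν : SignedMeasureOffZero d} (hν : ν.IsQuasiLevyType) (hA : ∀ z, 0 ≤ quadForm A z) (ε : ℝ) :
    ∫⁻ x in {x : 𝔼 | ‖x‖ ≤ ε}, ENNReal.ofReal (‖x‖ ^ 2) ∂ν.posPart ≤
      ENNReal.ofReal (∑ i, truncatedQuadForm A ν ε (EuclideanSpace.basisFun (Fin d) ℝ i)) := by
  rw [← ofReal_integral_eq_lintegral_ofReal (integrableOn_norm_sq hν.1 ε)
    (Eventually.of_forall fun x => by positivity)]
  refine ENNReal.ofReal_le_ofReal ?_
  simp only [← (EuclideanSpace.basisFun (Fin d) ℝ).sum_sq_inner_right]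
  rw [integral_finsetSum _ fun i _ => integrableOn_inner_sq hν.1 ε _]
  exact Finset.sum_le_sum fun i _ => le_add_of_nonneg_left (hA _)

/-! ### Convergence of the characteristic exponents -/

theorem integral_eq_cutoff_add {m : Measure 𝔼} {g : 𝔼 → ℂ} (hg : Integrable g m) (ε : ℝ) :
    ∫ x, g x ∂m = ∫ x, ((1 - nearCutoff ε x : ℝ) : ℂ) * g x ∂m
      + ∫ x, (nearCutoff ε x : ℂ) * g x ∂m := by
  have h := integrable_nearCutoff_mul hg ε
  have h' : Integrable (fun x => ((1 - nearCutoff ε x : ℝ) : ℂ) * g x) m := by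
    refine (hg.sub h).congr (Eventually.of_forall fun x => ?_)
    simp [sub_mul]
  rw [← integral_add h' h]
  congr 1 with x
  push_cast
  ring

theorem integral_nearCutoff_mul_add_sq {m : Measure 𝔼}
    (hm : Integrable (fun x => min (1 : ℝ) (‖x‖ ^ 2)) m) {g : 𝔼 → ℂ} (hg : Integrable g m)
    {ε : ℝ} (hε : 0 < ε) (z : 𝔼) :
    ∫ x, (nearCutoff ε x : ℂ) * (g x + ((⟪z, x⟫ ^ 2 / 2 : ℝ) : ℂ)) ∂m =
      ∫ x, (nearCutoff ε x : ℂ) * g x ∂m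
        + 1 / 2 * ((∫ x, nearCutoff ε x * ⟪z, x⟫ ^ 2 ∂m : ℝ) : ℂ) := by
  have h1 := integrable_nearCutoff_mul hg ε
  have h2 := ((integrable_nearCutoff_mul_inner_sq hm hε z).ofReal (𝕜 := ℂ)).const_mul (1 / 2)
  have h3 := integral_add h1 h2
  rw [integral_const_mul] at h3
  rw [← integral_complex_ofReal]
  refine Eq.trans ?_ h3
  congr 1 with x
  simp only [RCLike.ofReal_eq_complex_ofReal]
  push_cast
  ring

theorem eventually_eventually_lt_of_limsup {u : ℝ → ℕ → ℝ≥0∞}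
    (h : Tendsto (fun ε => limsup (u ε) atTop) (𝓝[>] 0) (𝓝 0)) {δ : ℝ≥0∞} (hδ : 0 < δ) :
    ∀ᶠ ε in 𝓝[>] 0, ∀ᶠ n in atTop, u ε n < δ := by
  filter_upwards [(tendsto_order.1 h).2 δ hδ] with ε hε
  exact eventually_lt_of_limsup_lt hε

theorem eventually_abs_truncatedQuadForm_sub_lt {A_seq : ℕ → Matrix (Fin d) (Fin d) ℝ}
    {ν_seq : ℕ → SignedMeasureOffZero d} {A : Matrix (Fin d) (Fin d) ℝ} {z : 𝔼}
    (h : Tendsto (fun ε : ℝ => limsup (fun n => ENNReal.ofReal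
          |truncatedQuadForm (A_seq n) (ν_seq n) ε z - quadForm A z|) atTop) (𝓝[>] 0) (𝓝 0))
    {δ : ℝ} (hδ : 0 < δ) :
    ∀ᶠ ε in 𝓝[>] 0, ∀ᶠ n in atTop,
      |truncatedQuadForm (A_seq n) (ν_seq n) ε z - quadForm A z| < δ := by
  filter_upwards [eventually_eventually_lt_of_limsup h (ENNReal.ofReal_pos.2 hδ)] with ε hε
  filter_upwards [hε] with n hn
  exact (ENNReal.ofReal_lt_ofReal_iff hδ).1 hn

theorem exists_lintegral_norm_sq_le {A_seq : ℕ → Matrix (Fin d) (Fin d) ℝ}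
    {ν_seq : ℕ → SignedMeasureOffZero d} {A : Matrix (Fin d) (Fin d) ℝ}
    (hν : ∀ n, (ν_seq n).IsQuasiLevyType) (hA : ∀ n z, 0 ≤ quadForm (A_seq n) z)
    (h : ∀ z : 𝔼, Tendsto (fun ε : ℝ => limsup (fun n => ENNReal.ofReal
          |truncatedQuadForm (A_seq n) (ν_seq n) ε z - quadForm A z|) atTop) (𝓝[>] 0) (𝓝 0)) :
    ∃ R : ℝ, 0 < R ∧ ∀ᶠ ε in 𝓝[>] 0, ∀ᶠ n in atTop,
      ∫⁻ x in {x : 𝔼 | ‖x‖ ≤ ε}, ENNReal.ofReal (‖x‖ ^ 2) ∂(ν_seq n).posPart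
        ≤ ENNReal.ofReal R := by
  set e : Fin d → 𝔼 := fun i => EuclideanSpace.basisFun (Fin d) ℝ i with he
  -- Each truncated form is eventually within `1` of its limit. The `max 1` makes `R` positive, also
  -- when `d = 0` and the sum is empty, so that one may divide by it.
  refine ⟨max 1 (∑ i, (quadForm A (e i) + 1)), by positivity, ?_⟩
  have h1 : ∀ᶠ ε in 𝓝[>] 0, ∀ i, ∀ᶠ n in atTop,
      |truncatedQuadForm (A_seq n) (ν_seq n) ε (e i) - quadForm A (e i)| < 1 :=
    eventually_all.2 fun i => eventually_abs_truncatedQuadForm_sub_lt (h (e i)) one_pos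
  filter_upwards [h1] with ε hε
  filter_upwards [eventually_all.2 hε] with n hn
  refine (integral_norm_sq_le_sum_truncatedQuadForm (hν n) (hA n) ε).trans
    (ENNReal.ofReal_le_ofReal ((Finset.sum_le_sum fun i _ => ?_).trans (le_max_right _ _)))
  linarith [(abs_lt.1 (hn i)).2]

theorem norm_le_of_enorm_le_ofReal {a : ℂ} {δ : ℝ} (h : ‖a‖ₑ ≤ ENNReal.ofReal δ) (hδ : 0 ≤ δ) :
    ‖a‖ ≤ δ := by
  rwa [← ofReal_norm, ENNReal.ofReal_le_ofReal_iff hδ] at h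

theorem tendsto_characteristicExponent {c : 𝔼 → 𝔼} (hc : IsRepresentationFunction c)
    (hcont : Continuous c) {A_seq : ℕ → Matrix (Fin d) (Fin d) ℝ}
    {ν_seq : ℕ → SignedMeasureOffZero d} {γ_seq : ℕ → 𝔼} {A : Matrix (Fin d) (Fin d) ℝ}
    {ν : SignedMeasureOffZero d} {γ : 𝔼}
    (hν_seq : ∀ n, (ν_seq n).IsQuasiLevyType) (hν : ν.IsQuasiLevyType)
    (hA : ∀ n z, 0 ≤ quadForm (A_seq n) z)
    (h_pos : ∀ f ∈ cSharp d,
      Tendsto (fun n => ∫ x, f x ∂(ν_seq n).posPart) atTop (𝓝 (∫ x, f x ∂ν.posPart)))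
    (h_neg : ∀ f ∈ cSharp d,
      Tendsto (fun n => ∫ x, f x ∂(ν_seq n).negPart) atTop (𝓝 (∫ x, f x ∂ν.negPart)))
    (h_gauss : ∀ z : 𝔼, Tendsto (fun ε : ℝ => limsup (fun n => ENNReal.ofReal
          |truncatedQuadForm (A_seq n) (ν_seq n) ε z - quadForm A z|) atTop) (𝓝[>] 0) (𝓝 0))
    (h_small : Tendsto (fun ε : ℝ => limsup (fun n => ∫⁻ x in {x : 𝔼 | ‖x‖ ≤ ε},
          ENNReal.ofReal (‖x‖ ^ 2) ∂(ν_seq n).negPart) atTop) (𝓝[>] 0) (𝓝 0))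
    (hγ : Tendsto γ_seq atTop (𝓝 γ)) (z : 𝔼) :
    Tendsto (fun n => characteristicExponent c (A_seq n) (ν_seq n) (γ_seq n) z) atTop
      (𝓝 (characteristicExponent c A ν γ z)) := by
  obtain ⟨C, hC0, hC⟩ := exists_norm_levyKernel_le hc hcont z
  obtain ⟨R, hR0, hR⟩ := exists_lintegral_norm_sq_le hν_seq hA h_gauss
  set g := levyKernel c z with hg
  have hg0 : g 0 = 0 := by simpa using hC 0
  have hgc : Continuous g := continuous_levyKernel hcont z
  have hgi : ∀ {m : Measure 𝔼}, Integrable (fun x => min (1 : ℝ) (‖x‖ ^ 2)) m → Integrable g m :=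
    fun hm => integrable_levyKernel hc hcont hm z
  -- The final estimate has seven terms of size `δ` and one of size `C * δ`; dividing by `8 + C`
  -- makes the inequality strict.
  suffices H : ∀ δ : ℝ, 0 < δ → ∀ᶠ n in atTop,
      ‖characteristicExponent c (A_seq n) (ν_seq n) (γ_seq n) z -
        characteristicExponent c A ν γ z‖ ≤ (7 + C) * δ by
    refine Metric.tendsto_nhds.2 fun δ hδ => ?_
    filter_upwards [H (δ / (8 + C)) (by positivity)] with n hn
    rw [dist_eq_norm]
    refine hn.trans_lt ?_
    rw [mul_div_assoc', div_lt_iff₀ (by positivity)]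
    nlinarith
  intro δ hδ
  have hhalf : Tendsto (fun ε : ℝ => ε / 2) (𝓝[>] 0) (𝓝[>] 0) := by
    refine tendsto_nhdsWithin_iff.2 ⟨?_, ?_⟩
    · have : Continuous fun ε : ℝ => ε / 2 := by fun_prop
      simpa using (this.tendsto 0).mono_left nhdsWithin_le_nhds
    · filter_upwards [self_mem_nhdsWithin] with ε hε using half_pos (mem_Ioi.1 hε)
  have e1 := eventually_abs_truncatedQuadForm_sub_lt (h_gauss z) hδ
  have e2 := eventually_eventually_lt_of_limsup h_small (ENNReal.ofReal_pos.2 hδ)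
  have e4 : ∀ {m : Measure 𝔼}, Integrable (fun x => min (1 : ℝ) (‖x‖ ^ 2)) m →
      ∀ᶠ ε in 𝓝[>] 0, ‖∫ x, (nearCutoff ε x : ℂ) * g x ∂m‖ < δ := fun hm =>
    (tendsto_order.1 (tendsto_integral_nearCutoff_mul (hgi hm) hg0).norm).2 δ (by simpa using hδ)
  -- The factor `δ / R` cancels the uniform second-moment bound `R` on `ν_n^+`, leaving `δ`.
  have e5 : ∀ᶠ ε in 𝓝[>] (0 : ℝ), ∀ x : 𝔼, ‖x‖ ≤ ε →
      ‖g x + ((⟪z, x⟫ ^ 2 / 2 : ℝ) : ℂ)‖ ≤ δ / R * ‖x‖ ^ 2 := by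
    have h := (levyKernel_add_sq_isLittleO hc hcont z).bound (div_pos hδ hR0)
    obtain ⟨r, hr, hball⟩ := Metric.eventually_nhds_iff.1 h
    filter_upwards [Ioo_mem_nhdsGT hr] with ε hε x hx
    have := hball (y := x) (by simpa using hx.trans_lt hε.2)
    rwa [Real.norm_of_nonneg (by positivity)] at this
  -- A single `ε` is fixed before `n` varies; the Gaussian condition is requested at both `ε` and `ε
  -- / 2` for the sandwich in `b3`.
  obtain ⟨ε, hε, h1, h1', h2, h3, h4, h4', h5⟩ := (eventually_mem_nhdsWithin.and (e1.and
    ((hhalf.eventually e1).and (e2.and (hR.and ((e4 hν.1).and ((e4 hν.2).and e5))))))).exists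
  replace hε : 0 < ε := hε
  have t1 := (tendsto_order.1 (tendsto_iff_norm_sub_tendsto_zero.1
    (tendsto_integral_one_sub_nearCutoff_mul (fun n => (hν_seq n).1) hν.1 h_pos hgc hC hC0
      hε))).2 δ hδ
  have t2 := (tendsto_order.1 (tendsto_iff_norm_sub_tendsto_zero.1
    (tendsto_integral_one_sub_nearCutoff_mul (fun n => (hν_seq n).2) hν.2 h_neg hgc hC hC0
      hε))).2 δ hδ
  have t3 : ∀ᶠ n in atTop, |⟪γ_seq n, z⟫ - ⟪γ, z⟫| < δ :=
    (tendsto_order.1 (tendsto_iff_norm_sub_tendsto_zero.1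
      (Tendsto.inner (𝕜 := ℝ) hγ (tendsto_const_nhds (x := z))))).2 δ hδ
  filter_upwards [h1, h1', h2, h3, t1, t2, t3] with n h1 h1' h2 h3 t1 t2 t3
  have b1 : ‖∫ x, (nearCutoff ε x : ℂ) * g x ∂(ν_seq n).negPart‖ ≤ C * δ := by
    refine norm_le_of_enorm_le_ofReal ?_ (by positivity)
    rw [ENNReal.ofReal_mul hC0]
    refine (enorm_integral_nearCutoff_mul_le _ hε fun x _ => (hC x).trans
      (mul_le_mul_of_nonneg_left (min_le_right _ _) hC0)).trans ?_
    gcongr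
  have b2 : ‖∫ x, (nearCutoff ε x : ℂ) * (g x + ((⟪z, x⟫ ^ 2 / 2 : ℝ) : ℂ))
      ∂(ν_seq n).posPart‖ ≤ δ := by
    refine norm_le_of_enorm_le_ofReal ?_ hδ.le
    refine (enorm_integral_nearCutoff_mul_le _ hε h5).trans ?_
    calc _ ≤ ENNReal.ofReal (δ / R) * ENNReal.ofReal R := by gcongr
      _ = ENNReal.ofReal δ := by
        rw [← ENNReal.ofReal_mul (by positivity), div_mul_cancel₀ _ hR0.ne']
  have b3 : |quadForm (A_seq n) z + ∫ x, nearCutoff ε x * ⟪z, x⟫ ^ 2 ∂(ν_seq n).posPart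
      - quadForm A z| < δ := by
    have hI := integral_nearCutoff_mul_inner_sq_mem (hν_seq n).1 hε z
    rw [truncatedQuadForm, abs_lt] at h1 h1'
    rw [abs_lt]
    constructor <;> linarith [hI.1, hI.2]
  have hΨ : ∀ (A' : Matrix (Fin d) (Fin d) ℝ) (ν' : SignedMeasureOffZero d) (γ' : 𝔼),
      characteristicExponent c A' ν' γ' z = Complex.I * (⟪γ', z⟫ : ℝ)
        - 1 / 2 * (quadForm A' z : ℝ) + (∫ x, g x ∂ν'.posPart - ∫ x, g x ∂ν'.negPart) :=
    fun _ _ _ => rfl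
  rw [integral_nearCutoff_mul_add_sq (hν_seq n).1 (hgi (hν_seq n).1) hε] at b2
  rw [hΨ, hΨ, integral_eq_cutoff_add (hgi (hν_seq n).1) ε,
    integral_eq_cutoff_add (hgi (hν_seq n).2) ε, integral_eq_cutoff_add (hgi hν.1) ε,
    integral_eq_cutoff_add (hgi hν.2) ε]
  -- With the integrals as atoms the rest is algebra: `p`, `q` are far parts and `r`, `s` near parts
  -- for `ν⁺`, `ν⁻`, index `1` refers to `ν_n` and `2` to `ν`. Adding and subtracting `J / 2` pairs
  -- `r₁` with its quadratic term and `J` with the Gaussian form.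
  generalize (∫ x, ((1 - nearCutoff ε x : ℝ) : ℂ) * g x ∂(ν_seq n).posPart) = p₁ at *
  generalize (∫ x, ((1 - nearCutoff ε x : ℝ) : ℂ) * g x ∂ν.posPart) = p₂ at *
  generalize (∫ x, ((1 - nearCutoff ε x : ℝ) : ℂ) * g x ∂(ν_seq n).negPart) = q₁ at *
  generalize (∫ x, ((1 - nearCutoff ε x : ℝ) : ℂ) * g x ∂ν.negPart) = q₂ at *
  generalize (∫ x, (nearCutoff ε x : ℂ) * g x ∂(ν_seq n).posPart) = r₁ at *
  generalize (∫ x, (nearCutoff ε x : ℂ) * g x ∂ν.posPart) = r₂ at *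
  generalize (∫ x, (nearCutoff ε x : ℂ) * g x ∂(ν_seq n).negPart) = s₁ at *
  generalize (∫ x, (nearCutoff ε x : ℂ) * g x ∂ν.negPart) = s₂ at *
  generalize (∫ x, nearCutoff ε x * ⟪z, x⟫ ^ 2 ∂(ν_seq n).posPart) = J at *
  have b3' : ‖(1 / 2 : ℂ) * ((quadForm (A_seq n) z + J - quadForm A z : ℝ) : ℂ)‖ ≤ δ := by
    rw [norm_mul, Complex.norm_real, Real.norm_eq_abs]
    norm_num
    linarith
  have t3' : ‖Complex.I * ((⟪γ_seq n, z⟫ - ⟪γ, z⟫ : ℝ) : ℂ)‖ ≤ δ := by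
    rw [norm_mul, Complex.norm_real, Complex.norm_I, one_mul]
    exact t3.le
  have split : Complex.I * ((⟪γ_seq n, z⟫ : ℝ) : ℂ) - 1 / 2 * ((quadForm (A_seq n) z : ℝ) : ℂ)
        + (p₁ + r₁ - (q₁ + s₁))
      - (Complex.I * ((⟪γ, z⟫ : ℝ) : ℂ) - 1 / 2 * ((quadForm A z : ℝ) : ℂ)
        + (p₂ + r₂ - (q₂ + s₂))) =
      Complex.I * ((⟪γ_seq n, z⟫ - ⟪γ, z⟫ : ℝ) : ℂ) + (p₁ - p₂) - (q₁ - q₂) - r₂ + s₂ - s₁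
        + (r₁ + 1 / 2 * (J : ℂ))
        - (1 / 2 : ℂ) * ((quadForm (A_seq n) z + J - quadForm A z : ℝ) : ℂ) := by
    push_cast
    ring
  rw [split]
  refine (norm_sub_le_of_le (norm_add_le_of_le (norm_sub_le_of_le (norm_add_le_of_le
    (norm_sub_le_of_le (norm_sub_le_of_le (norm_add_le_of_le t3' t1.le) t2.le) h4.le) h4'.le)
    b1) b2) b3').trans ?_
  linarith

end QID

end

/-- Sufficient condition for weak convergence of quasi-infinitely divisible distributions.
Upper limits are taken in `[0, ∞]`. -/
theorem mainTheorem6 (d : ℕ)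
    (c : EuclideanSpace ℝ (Fin d) → EuclideanSpace ℝ (Fin d))
    (hc : QID.IsRepresentationFunction c) (hc_cont : Continuous c)
    (μ_seq : ℕ → ProbabilityMeasure (EuclideanSpace ℝ (Fin d)))
    (A_seq : ℕ → Matrix (Fin d) (Fin d) ℝ) (ν_seq : ℕ → QID.SignedMeasureOffZero d)
    (γ_seq : ℕ → EuclideanSpace ℝ (Fin d))
    (hμ_seq : ∀ n, QID.HasCharacteristicTriplet c (μ_seq n) (A_seq n) (ν_seq n) (γ_seq n))
    (μ : ProbabilityMeasure (EuclideanSpace ℝ (Fin d)))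
    (A : Matrix (Fin d) (Fin d) ℝ) (ν : QID.SignedMeasureOffZero d)
    (γ : EuclideanSpace ℝ (Fin d))
    (hμ : QID.HasCharacteristicTriplet c μ A ν γ)
    (h_pos : ∀ f ∈ QID.cSharp d,
      Tendsto (fun n => ∫ x, f x ∂(ν_seq n).posPart) atTop (𝓝 (∫ x, f x ∂ν.posPart)))
    (h_neg : ∀ f ∈ QID.cSharp d,
      Tendsto (fun n => ∫ x, f x ∂(ν_seq n).negPart) atTop (𝓝 (∫ x, f x ∂ν.negPart)))
    (h_gauss : ∀ z : EuclideanSpace ℝ (Fin d),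
      Tendsto (fun ε : ℝ => limsup (fun n => ENNReal.ofReal
          |QID.truncatedQuadForm (A_seq n) (ν_seq n) ε z - QID.quadForm A z|) atTop)
        (𝓝[>] 0) (𝓝 0))
    (h_small : Tendsto (fun ε : ℝ => limsup (fun n =>
          ∫⁻ x in {x : EuclideanSpace ℝ (Fin d) | ‖x‖ ≤ ε},
            ENNReal.ofReal (‖x‖ ^ 2) ∂(ν_seq n).negPart) atTop)
        (𝓝[>] 0) (𝓝 0))
    (hγ : Tendsto γ_seq atTop (𝓝 γ)) :
    Tendsto μ_seq atTop (𝓝 μ) := by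
  refine ProbabilityMeasure.tendsto_iff_tendsto_charFun.2 fun z => ?_
  have h := QID.tendsto_characteristicExponent hc hc_cont
    (fun n => (hμ_seq n).isQuasiLevyType) hμ.isQuasiLevyType
    (fun n => (hμ_seq n).quadForm_nonneg hc hc_cont) h_pos h_neg h_gauss h_small hγ z
  rw [hμ.charFun_eq]
  simp only [fun n => (hμ_seq n).charFun_eq z]
  exact (Complex.continuous_exp.tendsto _).comp h
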